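/- Let each of $\alpha,\beta,\gamma$ be either $0$ or the reciprocal of a positive integer, with $\alpha+\beta+\gamma<1$. Let $D\subset\mathbb C$ be an open disc or open half-plane, regarded as a model of the hyperbolic plane, and let $s(z)=S(\alpha,\beta,\gamma;z)$ be a Schwarz triangle function on $D$: a meromorphic function on $D$ that maps the interior of some hyperbolic triangle $T$ in $D$, with interior angles $\alpha\pi,\beta\pi,\gamma\pi$ at its vertices $z_0,z_1,z_\infty$ (a vertex with angle $0$ being an ideal vertex, on the boundary of $D$), conformally onto the upper half-plane, in such a way that $s\to 0,1,\infty$ at $z_0,z_1,z_\infty$ respectively. Put $$w_1=\tfrac12\Big[\log\frac{s'}{s}\Big]',\qquad w_2=\tfrac12\Big[\log\frac{s'}{s-1}\Big]',\qquad w_3=\tfrac12\Big[\log\frac{s'}{s(s-1)}\Big]' ,$$ and let $a_1,a_2,a_3\in\mathbb C$ be constants, not all zero. Suppose that the meromorphic function $y=a_1w_1+a_2w_2+a_3w_3$ on $D$ is a solution of the Chazy equation $y'''=2yy''-3y'^2$. If $y$ is holomorphic on $D$, then at least one of $\alpha,\beta,\gamma$ is zero. -/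

import Mathlib

open Filter Topology

noncomputable section

/-- Change of coordinate from the Poincaré disc model to the Klein disc model of the hyperbolic
plane. It fixes every point of the unit circle and carries hyperbolic geodesics (arcs of circles
orthogonal to the unit circle) to straight chords. -/
def kleinPoint (z : ℂ) : ℂ := (2 / (1 + ‖z‖ ^ 2) : ℝ) • z

/-- The open hyperbolic triangle in the unit disc (Poincaré model) with vertices `a`, `b`, `c`
in the closed unit disc; vertices on the unit circle are ideal vertices. Its sides are arcs of
circles orthogonal to the unit circle, i.e. straight segments in the Klein model. -/
def hyperbolicTriangle (a b c : ℂ) : Set ℂ :=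
  {z | ‖z‖ < 1 ∧
    kleinPoint z ∈ interior (convexHull ℝ {kleinPoint a, kleinPoint b, kleinPoint c})}

/-- The automorphism of the unit disc that moves `a` to the origin. -/
def discTranslation (a z : ℂ) : ℂ := (z - a) / (1 - starRingEnd ℂ a * z)

/-- The interior angle at `a` of the hyperbolic triangle with vertices `a`, `b`, `c`. For `a` in
the open disc, one moves `a` to the origin by a (conformal) automorphism of the disc; the two
sides issuing from `a` then become radii. The angle at an ideal vertex is `0`. -/
def hyperbolicAngle (a b c : ℂ) : ℝ :=
  if ‖a‖ < 1 then InnerProductGeometry.angle (discTranslation a b) (discTranslation a c) else 0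

/-- `f` is a triangle function with angle parameters `α`, `β`, `γ`, defined on the unit disc:
`f` is meromorphic on the disc and maps the interior of a hyperbolic triangle, with interior angles
`απ`, `βπ`, `γπ` at its vertices `v₀`, `v₁`, `v₂`, conformally onto the upper half-plane in
such a way that `v₀`, `v₁`, `v₂` correspond to `0`, `1`, `∞`. (By the Schwarz reflection
principle and the identity theorem, `f` is the extension of this conformal map by successive
reflections in the sides of the triangle and of its images.) -/
def IsDiscTriangleFunction (α β γ : ℝ) (f : ℂ → ℂ) : Prop :=
  MeromorphicOn f (Metric.ball 0 1) ∧
  ∃ v₀ v₁ v₂ : ℂ, ‖v₀‖ ≤ 1 ∧ ‖v₁‖ ≤ 1 ∧ ‖v₂‖ ≤ 1 ∧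
    hyperbolicAngle v₀ v₁ v₂ = α * Real.pi ∧
    hyperbolicAngle v₁ v₂ v₀ = β * Real.pi ∧
    hyperbolicAngle v₂ v₀ v₁ = γ * Real.pi ∧
    DifferentiableOn ℂ f (hyperbolicTriangle v₀ v₁ v₂) ∧
    Set.BijOn f (hyperbolicTriangle v₀ v₁ v₂) {w | 0 < w.im} ∧
    Tendsto f (𝓝[hyperbolicTriangle v₀ v₁ v₂] v₀) (𝓝 0) ∧
    Tendsto f (𝓝[hyperbolicTriangle v₀ v₁ v₂] v₁) (𝓝 1) ∧
    Tendsto f (𝓝[hyperbolicTriangle v₀ v₁ v₂] v₂) (Bornology.cobounded ℂ)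

/-- `s` is a Schwarz triangle function `S(α, β, γ; z)` with domain of existence `D`: here `D` is
the image of the unit disc under a fractional linear transformation (so `D` is any open disc or open
half-plane in `ℂ`), and `s` becomes a triangle function on the unit disc in that coordinate. -/
def IsSchwarzTriangleFunction (α β γ : ℝ) (D : Set ℂ) (s : ℂ → ℂ) : Prop :=
  ∃ a b c d : ℂ, a * d - b * c ≠ 0 ∧
    (∀ ζ ∈ Metric.ball (0 : ℂ) 1, c * ζ + d ≠ 0) ∧
    D = (fun ζ => (a * ζ + b) / (c * ζ + d)) '' Metric.ball (0 : ℂ) 1 ∧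
    IsDiscTriangleFunction α β γ (fun ζ => s ((a * ζ + b) / (c * ζ + d)))

/-- The generalized Darboux-Halphen variable `w₁ = ½ [log (s' / s)]'`. -/
def gdhW₁ (s : ℂ → ℂ) (z : ℂ) : ℂ := 1 / 2 * logDeriv (fun t => deriv s t / s t) z

/-- The generalized Darboux-Halphen variable `w₂ = ½ [log (s' / (s - 1))]'`. -/
def gdhW₂ (s : ℂ → ℂ) (z : ℂ) : ℂ := 1 / 2 * logDeriv (fun t => deriv s t / (s t - 1)) z

/-- The generalized Darboux-Halphen variable `w₃ = ½ [log (s' / (s (s - 1)))]'`. -/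
def gdhW₃ (s : ℂ → ℂ) (z : ℂ) : ℂ :=
  1 / 2 * logDeriv (fun t => deriv s t / (s t * (s t - 1))) z

/-- `y` is a (meromorphic) solution on `D` of the Chazy equation `y''' = 2 y y'' - 3 y'²`.
The equation is required off a set without accumulation points in `D` (the poles). -/
def IsChazySolutionOn (y : ℂ → ℂ) (D : Set ℂ) : Prop :=
  MeromorphicOn y D ∧
  ∀ᶠ z in codiscreteWithin D,
    iteratedDeriv 3 y z = 2 * y z * iteratedDeriv 2 y z - 3 * deriv y z ^ 2

/-- `y = a₁ w₁ + a₂ w₂ + a₃ w₃` as meromorphic functions on `D`, the `wᵢ` being the generalized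
Darboux-Halphen variables of `s`. -/
def IsParametrizedBy (y : ℂ → ℂ) (D : Set ℂ) (s : ℂ → ℂ) (a₁ a₂ a₃ : ℂ) : Prop :=
  ∀ᶠ z in codiscreteWithin D, y z = a₁ * gdhW₁ s z + a₂ * gdhW₂ s z + a₃ * gdhW₃ s z

end

theorem tendsto_sub_mul_logDeriv {h : ℂ → ℂ} {p : ℂ} {n : ℤ}
    (hm : MeromorphicAt h p) (ho : meromorphicOrderAt h p = n) :
    Tendsto (fun z => (z - p) * logDeriv h z) (𝓝[≠] p) (𝓝 n) := by
  obtain ⟨g, hg, hgp, heq⟩ := (meromorphicOrderAt_eq_int_iff hm).1 ho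
  have h1 := logDeriv_congr_nhdsNE heq
  have h2 : Tendsto (fun z => (n : ℂ) + (z - p) * logDeriv g z) (𝓝[≠] p) (𝓝 n) := by
    have hc : ContinuousAt (fun z => (n : ℂ) + (z - p) * logDeriv g z) p := by
      have : ContinuousAt (logDeriv g) p := (hg.deriv.div hg hgp).continuousAt
      fun_prop
    have := hc.tendsto.mono_left (nhdsWithin_le_nhds (s := {p}ᶜ))
    simpa using this
  refine h2.congr' ?_
  filter_upwards [h1, hg.eventually_analyticAt.filter_mono nhdsWithin_le_nhds,
    (hg.continuousAt.eventually_ne hgp).filter_mono nhdsWithin_le_nhds,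
    self_mem_nhdsWithin] with z hz hga hgz hzp
  have hzp' : z - p ≠ 0 := sub_ne_zero.2 hzp
  rw [hz]
  simp only [smul_eq_mul]
  have hd : DifferentiableAt ℂ (fun z : ℂ => z - p) z := by fun_prop
  rw [logDeriv_mul (f := fun x => (x - p) ^ n) z (zpow_ne_zero _ hzp') hgz (hd.zpow (Or.inl hzp')) hga.differentiableAt,
    logDeriv_fun_zpow hd, logDeriv_apply (fun z => z - p)]
  have hd1 : deriv (fun z : ℂ => z - p) z = 1 := by simp
  rw [hd1]
  field_simp

theorem mem_interior_convexHull_triangle_iff {A B C : ℂ}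
    (h : (interior (convexHull ℝ {A, B, C})).Nonempty) (x y : ℝ) :
    A + x • (B - A) + y • (C - A) ∈ interior (convexHull ℝ {A, B, C}) ↔
      0 < x ∧ 0 < y ∧ x + y < 1 := by
  have hr : Set.range ![A, B, C] = {A, B, C} := by
    simp only [Matrix.range_cons, Matrix.range_empty, Set.union_empty, Set.singleton_union]
  rw [interior_convexHull_nonempty_iff_affineSpan_eq_top, ← hr] at h
  have hi : AffineIndependent ℝ ![A, B, C] := by
    rw [affineIndependent_iff_finrank_vectorSpan_eq ℝ _ (n := 2) (by simp),
      ← direction_affineSpan, h, AffineSubspace.direction_top, finrank_top,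
      Complex.finrank_real_complex]
  let b : AffineBasis (Fin 3) ℝ ℂ := ⟨![A, B, C], hi, h⟩
  have hb : ⇑b = ![A, B, C] := rfl
  have hw : ∑ i, (![1 - x - y, x, y] : Fin 3 → ℝ) i = 1 := by
    simp [Fin.sum_univ_three]
    ring
  have hp : A + x • (B - A) + y • (C - A) =
      Finset.univ.affineCombination ℝ b ![1 - x - y, x, y] := by
    rw [Finset.affineCombination_eq_linear_combination _ _ _ hw]
    simp [Fin.sum_univ_three, hb]
    ring
  rw [← hr, ← hb, b.interior_convexHull, hp]
  simp only [Set.mem_ofPred_eq, b.coord_apply_combination_of_mem (Finset.mem_univ _) hw]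
  simp only [Fin.forall_fin_succ, Matrix.cons_val_zero, Matrix.cons_val_succ, IsEmpty.forall_iff,
    and_true]
  constructor
  · rintro ⟨h1, h2, h3⟩
    exact ⟨h2, h3, by linarith⟩
  · rintro ⟨h1, h2, h3⟩
    exact ⟨by linarith, h1, h2⟩

theorem im_eq_zero_of_mem_closure_of_bijOn {g : ℂ → ℂ} {T : Set ℂ} {P : ℂ} (hT : IsOpen T)
    (hd : DifferentiableOn ℂ g T) (hb : Set.BijOn g T {w | 0 < w.im})
    (hP : P ∈ closure T) (hPT : P ∉ T) (hc : ContinuousAt g P) : (g P).im = 0 := by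
  have hne : (𝓝[T] P).NeBot := mem_closure_iff_nhdsWithin_neBot.1 hP
  have ht : Tendsto g (𝓝[T] P) (𝓝 (g P)) := hc.tendsto.mono_left nhdsWithin_le_nhds
  have h0 : 0 ≤ (g P).im :=
    ge_of_tendsto (Complex.continuous_im.continuousAt.tendsto.comp ht)
      (eventually_mem_nhdsWithin.mono fun z hz => (hb.mapsTo hz).le)
  by_contra hn
  obtain ⟨q, hqT, hq⟩ := hb.surjOn (show g P ∈ {w : ℂ | 0 < w.im} from
    lt_of_le_of_ne h0 (Ne.symm hn))
  have ha : AnalyticAt ℂ g q := hd.analyticAt (hT.mem_nhds hqT)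
  rcases ha.eventually_constant_or_nhds_le_map_nhds with h | h
  · obtain ⟨z, ⟨hz1, hz2⟩, hz3⟩ := ((((h.and (hT.mem_nhds hqT)).filter_mono
      (nhdsWithin_le_nhds (s := {q}ᶜ))).and eventually_mem_nhdsWithin)).exists
    exact hz3 (hb.injOn hz2 hqT hz1)
  · have hqP : q ≠ P := fun e => hPT (e ▸ hqT)
    obtain ⟨U, V, hU, hV, hqU, hPV, hUV⟩ := t2_separation hqP
    have h1 : g '' (U ∩ T) ∈ 𝓝 (g P) := by
      rw [← hq]
      exact h (image_mem_map ((hU.inter hT).mem_nhds ⟨hqU, hqT⟩))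
    obtain ⟨z, ⟨hz1, hz2⟩, hz3⟩ := (((ht.eventually h1).and
      (mem_nhdsWithin_of_mem_nhds (hV.mem_nhds hPV))).and
      eventually_mem_nhdsWithin).exists
    obtain ⟨z', ⟨hz'U, hz'T⟩, he⟩ := hz1
    have : z' = z := hb.injOn hz'T hz3 he
    exact Set.disjoint_left.1 hUV hz'U (this ▸ hz2)

theorem eq_of_im_pow_nonneg_sector {c u v : ℂ} {r : ℝ} {k l : ℕ} (hl : 2 ≤ l) (hk : 0 < k)
    (hc : c ≠ 0) (hu : u ≠ 0) (hr : 0 < r)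
    (hv : v = r * Complex.exp ((Real.pi / l : ℝ) * Complex.I) * u)
    (hcu : (c * u ^ k).im = 0) (hcv : (c * v ^ k).im = 0)
    (hin : ∀ x y : ℝ, 0 < x → 0 < y → 0 ≤ (c * (x * u + y * v) ^ k).im) : k = l := by
  have hπ := Real.pi_pos
  have hl0 : (0 : ℝ) < l := by positivity
  have hk0 : (0 : ℝ) < k := by positivity
  set φ := Real.pi / l with hφ
  have hφ0 : 0 < φ := by positivity
  have hφπ : φ < Real.pi := by
    rw [hφ, div_lt_iff₀ hl0]
    have : (2 : ℝ) ≤ l := by exact_mod_cast hl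
    nlinarith
  set R := (c * u ^ k).re with hR
  have hRc : c * u ^ k = (R : ℂ) := Complex.ext (by simp [hR]) (by simp [hcu])
  have hR0 : R ≠ 0 := fun h => mul_ne_zero hc (pow_ne_zero k hu) (by rw [hRc, h]; simp)
  have him : ∀ ρ θ : ℝ, (c * (ρ * Complex.exp (θ * Complex.I) * u) ^ k).im =
      R * ρ ^ k * Real.sin (k * θ) := by
    intro ρ θ
    have : c * (ρ * Complex.exp (θ * Complex.I) * u) ^ k =
        ((R * ρ ^ k : ℝ) : ℂ) * Complex.exp ((k * θ : ℝ) * Complex.I) := by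
      rw [mul_pow, mul_pow, ← Complex.exp_nat_mul]
      push_cast
      rw [← hRc, mul_assoc (k : ℂ)]
      ring
    rw [this, Complex.im_ofReal_mul, Complex.exp_ofReal_mul_I_im]
  have hs : Real.sin (k * φ) = 0 := by
    have h := him r φ
    rw [← hv, hcv] at h
    have := (mul_eq_zero.1 h.symm).resolve_left (mul_ne_zero hR0 (pow_ne_zero _ hr.ne'))
    exact this
  obtain ⟨j, hj⟩ := Real.sin_eq_zero_iff.1 hs
  have hjk : (j : ℝ) * l = k := by
    rw [hφ] at hj
    field_simp at hj
    linarith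
  have hjk' : j * l = k := by exact_mod_cast hjk
  have hj1 : 0 < j := by
    by_contra hneg
    have : j * l ≤ 0 := mul_nonpos_of_nonpos_of_nonneg (not_lt.1 hneg) (by positivity)
    omega
  have hsφ : 0 < Real.sin φ := Real.sin_pos_of_pos_of_lt_pi hφ0 hφπ
  have hdir : ∀ θ : ℝ, 0 < θ → θ < φ → 0 ≤ R * Real.sin (k * θ) := by
    intro θ h0 h1
    have h2 : 0 < Real.sin θ := Real.sin_pos_of_pos_of_lt_pi h0 (h1.trans hφπ)
    have h3 : 0 < Real.sin (φ - θ) :=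
      Real.sin_pos_of_pos_of_lt_pi (by linarith) (by linarith)
    have h4 := hin (Real.sin (φ - θ) / Real.sin φ) (Real.sin θ / (Real.sin φ * r))
      (by positivity) (by positivity)
    have h5 : ((Real.sin (φ - θ) / Real.sin φ : ℝ) : ℂ) * u +
        ((Real.sin θ / (Real.sin φ * r) : ℝ) : ℂ) * v =
        ((1 : ℝ) : ℂ) * Complex.exp (θ * Complex.I) * u := by
      have h6 : (Real.sin φ : ℂ) ≠ 0 := by exact_mod_cast hsφ.ne'
      have h7 : (r : ℂ) ≠ 0 := by exact_mod_cast hr.ne'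
      rw [hv, Complex.exp_mul_I, Complex.exp_mul_I, Real.sin_sub]
      push_cast at h6 ⊢
      field_simp
      ring
    rw [h5, him] at h4
    simpa using h4
  have hj2 : j < 2 := by
    by_contra hge
    have hkl : (2 : ℝ) * l ≤ k := by
      rw [← hjk]
      have : (2 : ℝ) ≤ j := by exact_mod_cast not_lt.1 hge
      gcongr
    have e1 := hdir (Real.pi / (2 * k)) (by positivity) (by
      rw [hφ]; gcongr; nlinarith)
    have e2 := hdir (3 * Real.pi / (2 * k)) (by positivity) (by
      rw [hφ, div_lt_div_iff₀ (by positivity) hl0]; nlinarith)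
    rw [show (k : ℝ) * (Real.pi / (2 * k)) = Real.pi / 2 by field_simp, Real.sin_pi_div_two] at e1
    rw [show (k : ℝ) * (3 * Real.pi / (2 * k)) = Real.pi / 2 + Real.pi by field_simp; ring,
      Real.sin_add_pi, Real.sin_pi_div_two] at e2
    exact hR0 (by linarith)
  have : j = 1 := by omega
  subst this
  omega

theorem tendsto_ofReal_mul_nhdsNE_zero {w : ℂ} (hw : w ≠ 0) :
    Tendsto (fun t : ℝ => (t : ℂ) * w) (𝓝[>] 0) (𝓝[≠] 0) := by
  refine tendsto_nhdsWithin_iff.2 ⟨?_, ?_⟩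
  · have : Continuous fun t : ℝ => (t : ℂ) * w := by fun_prop
    simpa using (this.tendsto 0).mono_left nhdsWithin_le_nhds
  · filter_upwards [self_mem_nhdsWithin] with t ht
    have : (t : ℂ) ≠ 0 := by exact_mod_cast (ne_of_gt ht)
    exact mul_ne_zero this hw

theorem meromorphicOrderAt_eq_of_sector {F : ℂ → ℂ} {u v : ℂ} {l : ℕ} (hl : 2 ≤ l)
    (hu : u ≠ 0) (hv : v ≠ 0) (hang : InnerProductGeometry.angle u v = Real.pi / l)
    (hF : MeromorphicAt F 0) (hpos : 0 < meromorphicOrderAt F 0)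
    (hur : ∀ᶠ t : ℝ in 𝓝[>] 0, (F (t * u)).im = 0)
    (hvr : ∀ᶠ t : ℝ in 𝓝[>] 0, (F (t * v)).im = 0)
    (hin : ∀ x y : ℝ, 0 < x → 0 < y → ∀ᶠ t : ℝ in 𝓝[>] 0, 0 < (F (t * (x * u + y * v))).im) :
    meromorphicOrderAt F 0 = (l : ℤ) := by
  have hne : ∀ x y : ℝ, 0 < x → 0 < y → (x : ℂ) * u + y * v ≠ 0 := by
    intro x y hx hy h0
    have h1 : v = ((-(x / y) : ℝ) : ℂ) * u := by
      have : (y : ℂ) ≠ 0 := by exact_mod_cast hy.ne'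
      push_cast
      field_simp
      linear_combination h0
    have h2 : InnerProductGeometry.angle u v = Real.pi := by
      rw [InnerProductGeometry.angle_eq_pi_iff]
      exact ⟨hu, -(x / y), neg_neg_of_pos (by positivity), by rw [h1, Complex.real_smul]⟩
    rw [h2] at hang
    have : (2 : ℝ) ≤ l := by exact_mod_cast hl
    rw [eq_div_iff (by positivity)] at hang
    nlinarith [Real.pi_pos]
  have hntop : meromorphicOrderAt F 0 ≠ ⊤ := by
    intro htop
    have h0 := (tendsto_ofReal_mul_nhdsNE_zero (hne 1 1 one_pos one_pos)).eventually
      (meromorphicOrderAt_eq_top_iff.1 htop)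
    obtain ⟨t, h1, h2⟩ := (h0.and (hin 1 1 one_pos one_pos)).exists
    rw [h1] at h2
    simp at h2
  obtain ⟨m, hm⟩ := WithTop.ne_top_iff_exists.1 hntop
  rw [← hm] at hpos
  have hm0 : 0 < m := by exact_mod_cast hpos
  obtain ⟨k, rfl⟩ := Int.eq_ofNat_of_zero_le hm0.le
  have hk : 0 < k := by exact_mod_cast hm0
  obtain ⟨G, hG, hG0, heq⟩ := (meromorphicOrderAt_eq_int_iff hF).1 hm.symm
  have hlim : ∀ w : ℂ, w ≠ 0 →
      Tendsto (fun t : ℝ => (F (t * w)).im / t ^ k) (𝓝[>] 0) (𝓝 (G 0 * w ^ k).im) := by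
    intro w hw
    have h1 : Tendsto (fun t : ℝ => (G (t * w) * w ^ k).im) (𝓝[>] 0) (𝓝 (G 0 * w ^ k).im) := by
      have hG' : Tendsto G (𝓝[≠] 0) (𝓝 (G 0)) :=
        hG.continuousAt.tendsto.mono_left nhdsWithin_le_nhds
      exact (Complex.continuous_im.tendsto _).comp ((hG'.comp (tendsto_ofReal_mul_nhdsNE_zero hw)).mul_const _)
    refine h1.congr' ?_
    filter_upwards [(tendsto_ofReal_mul_nhdsNE_zero hw).eventually heq, self_mem_nhdsWithin] with t ht ht0
    have ht0' : t ^ k ≠ 0 := pow_ne_zero _ (ne_of_gt ht0)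
    rw [ht, eq_div_iff ht0', mul_comm, ← Complex.im_ofReal_mul]
    congr 1
    simp only [sub_zero, smul_eq_mul, zpow_natCast, mul_pow]
    push_cast
    ring
  have hu' : (G 0 * u ^ k).im = 0 :=
    tendsto_nhds_unique (hlim u hu)
      (tendsto_const_nhds.congr' (hur.mono fun t ht => by simp [ht]))
  have hv' : (G 0 * v ^ k).im = 0 :=
    tendsto_nhds_unique (hlim v hv)
      (tendsto_const_nhds.congr' (hvr.mono fun t ht => by simp [ht]))
  have hin' : ∀ x y : ℝ, 0 < x → 0 < y → 0 ≤ (G 0 * (x * u + y * v) ^ k).im := by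
    intro x y hx hy
    refine ge_of_tendsto (hlim _ (hne x y hx hy)) ?_
    filter_upwards [hin x y hx hy, self_mem_nhdsWithin] with t ht ht0
    have : (0 : ℝ) < t := ht0
    positivity
  have key : k = l := by
    rw [Complex.angle_eq_abs_arg hu hv] at hang
    rcases le_total 0 (u / v).arg with hs | hs
    · rw [abs_of_nonneg hs] at hang
      refine eq_of_im_pow_nonneg_sector (u := v) (v := u) (r := ‖u / v‖) hl hk hG0 hv
        (norm_pos_iff.2 (div_ne_zero hu hv)) ?_ hv' hu' fun x y hx hy => ?_
      · rw [← hang, Complex.norm_mul_exp_arg_mul_I, div_mul_cancel₀ _ hv]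
      · rw [add_comm]
        exact hin' y x hy hx
    · rw [abs_of_nonpos hs] at hang
      refine eq_of_im_pow_nonneg_sector (u := u) (v := v) (r := ‖u / v‖⁻¹) hl hk hG0 hu
        (inv_pos.2 (norm_pos_iff.2 (div_ne_zero hu hv))) ?_ hu' hv' hin'
      rw [← hang]
      have h := Complex.norm_mul_exp_arg_mul_I (u / v)
      have h2 : v = (u / v)⁻¹ * u := by field_simp
      rw [← h, mul_inv, ← Complex.exp_neg] at h2
      push_cast
      rwa [neg_mul]
  rw [← hm, key]

noncomputable section

/-- The inverse of `discTranslation a`. -/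
def discTranslationInv (a w : ℂ) : ℂ := (w + a) / (1 + starRingEnd ℂ a * w)

/-- A positive multiple of the differential of `kleinPoint` at `a`. -/
def kleinDifferential (a w : ℂ) : ℂ :=
  ((1 + ‖a‖ ^ 2 : ℝ) : ℂ) * w - ((2 * (starRingEnd ℂ a * w).re : ℝ) : ℂ) * a

theorem kleinDifferential_linear (a u v : ℂ) (x y : ℝ) :
    kleinDifferential a (x * u + y * v) =
      x * kleinDifferential a u + y * kleinDifferential a v := by
  have : (starRingEnd ℂ a * (x * u + y * v)).re =
      x * (starRingEnd ℂ a * u).re + y * (starRingEnd ℂ a * v).re := by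
    simp
    ring
  simp only [kleinDifferential, this]
  push_cast
  ring

theorem one_sub_conj_mul_ne_zero {a b : ℂ} (ha : ‖a‖ < 1) (hb : ‖b‖ < 1) :
    1 - starRingEnd ℂ a * b ≠ 0 := by
  intro h
  have h1 : ‖starRingEnd ℂ a * b‖ = 1 := by rw [← sub_eq_zero.1 h]; simp
  rw [norm_mul, RCLike.norm_conj] at h1
  nlinarith [norm_nonneg a, norm_nonneg b]

theorem kleinPoint_sub_eq {a b : ℂ} (ha : ‖a‖ < 1) (hb : ‖b‖ < 1) :
    ∃ r : ℝ, 0 < r ∧ r ≤ 8 / (1 - ‖a‖ ^ 2) ∧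
      kleinPoint b - kleinPoint a = r * kleinDifferential a (discTranslation a b) := by
  have hn := one_sub_conj_mul_ne_zero ha hb
  have ha2 : 0 < 1 - ‖a‖ ^ 2 := by nlinarith [norm_nonneg a]
  have hN : 0 < ‖1 - starRingEnd ℂ a * b‖ := norm_pos_iff.2 hn
  have hN2 : ‖1 - starRingEnd ℂ a * b‖ ≤ 2 := by
    refine (norm_sub_le _ _).trans ?_
    rw [norm_mul, RCLike.norm_conj, norm_one]
    nlinarith [norm_nonneg a, norm_nonneg b]
  refine ⟨2 * ‖1 - starRingEnd ℂ a * b‖ ^ 2 /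
    ((1 + ‖a‖ ^ 2) * (1 + ‖b‖ ^ 2) * (1 - ‖a‖ ^ 2)), by positivity, ?_, ?_⟩
  · rw [div_le_div_iff₀ (by positivity) ha2]
    have h1 : 1 ≤ (1 + ‖a‖ ^ 2) * (1 + ‖b‖ ^ 2) :=
      one_le_mul_of_one_le_of_one_le (by simp) (by simp)
    have h2 : ‖1 - starRingEnd ℂ a * b‖ ^ 2 ≤ 4 := by nlinarith
    have h3 : 2 * ‖1 - starRingEnd ℂ a * b‖ ^ 2 ≤ 8 * ((1 + ‖a‖ ^ 2) * (1 + ‖b‖ ^ 2)) := by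
      linarith
    nlinarith
  · have hre : ∀ w : ℂ, ((2 * w.re : ℝ) : ℂ) = w + starRingEnd ℂ w := fun w =>
      (Complex.add_conj w).symm
    have hsq : ∀ w : ℂ, ((‖w‖ ^ 2 : ℝ) : ℂ) = w * starRingEnd ℂ w := fun w => by
      rw [Complex.mul_conj, Complex.normSq_eq_norm_sq]
    have e1 : (1 + a * starRingEnd ℂ a) ≠ 0 := by
      rw [← hsq]; exact_mod_cast (by positivity : (1 + ‖a‖ ^ 2 : ℝ) ≠ 0)
    have e2 : (1 + b * starRingEnd ℂ b) ≠ 0 := by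
      rw [← hsq]; exact_mod_cast (by positivity : (1 + ‖b‖ ^ 2 : ℝ) ≠ 0)
    have e3 : (1 - a * starRingEnd ℂ a) ≠ 0 := by
      rw [← hsq]; exact_mod_cast ha2.ne'
    have e4 : 1 - a * starRingEnd ℂ b ≠ 0 := by
      have := (map_ne_zero (starRingEnd ℂ)).2 hn
      simpa using this
    simp only [kleinPoint, kleinDifferential, discTranslation, Complex.real_smul,
      Complex.ofReal_div, Complex.ofReal_mul, Complex.ofReal_add, Complex.ofReal_sub, hsq,
      Complex.ofReal_one, Complex.ofReal_ofNat]
    simp only [← Complex.ofReal_ofNat, ← Complex.ofReal_mul, hre]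
    simp only [Complex.ofReal_ofNat, map_mul, map_div₀, map_sub, map_one, Complex.conj_conj]
    have hn' : 1 - b * starRingEnd ℂ a ≠ 0 := by rwa [mul_comm]
    have e5 : 1 - starRingEnd ℂ b * a ≠ 0 := by rwa [mul_comm]
    field_simp
    ring

theorem discTranslation_discTranslationInv {a w : ℂ} (ha : ‖a‖ < 1)
    (hw : 1 + starRingEnd ℂ a * w ≠ 0) :
    discTranslation a (discTranslationInv a w) = w := by
  have ha2 : 0 < 1 - ‖a‖ ^ 2 := by nlinarith [norm_nonneg a]
  have e3 : 1 - starRingEnd ℂ a * a ≠ 0 := by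
    rw [mul_comm, Complex.mul_conj, Complex.normSq_eq_norm_sq]; exact_mod_cast ha2.ne'
  have h2 : 1 - starRingEnd ℂ a * discTranslationInv a w =
      (1 - starRingEnd ℂ a * a) / (1 + starRingEnd ℂ a * w) := by
    rw [discTranslationInv]; field_simp; ring
  have hw' : 1 + w * starRingEnd ℂ a ≠ 0 := by rwa [mul_comm w]
  have h3 : discTranslationInv a w - a =
      w * (1 - starRingEnd ℂ a * a) / (1 + starRingEnd ℂ a * w) := by
    rw [discTranslationInv]; field_simp; ring
  rw [discTranslation, h2, h3, div_div_div_cancel_right₀ hw, mul_div_cancel_right₀ _ e3]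

theorem analyticAt_discTranslationInv {a w : ℂ} (hw : 1 + starRingEnd ℂ a * w ≠ 0) :
    AnalyticAt ℂ (discTranslationInv a) w := by
  unfold discTranslationInv
  exact AnalyticAt.div (by fun_prop) (by fun_prop) hw

theorem deriv_discTranslationInv_zero {a : ℂ} (ha : ‖a‖ < 1) :
    deriv (discTranslationInv a) 0 ≠ 0 := by
  have ha2 : 0 < 1 - ‖a‖ ^ 2 := by nlinarith [norm_nonneg a]
  have e3 : 1 - a * starRingEnd ℂ a ≠ 0 := by
    rw [Complex.mul_conj, Complex.normSq_eq_norm_sq]; exact_mod_cast ha2.ne'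
  have h1 : HasDerivAt (fun w : ℂ => w + a) 1 0 := (hasDerivAt_id' (0 : ℂ)).add_const a
  have h2 : HasDerivAt (fun w : ℂ => 1 + starRingEnd ℂ a * w) (starRingEnd ℂ a) 0 := by
    simpa using ((hasDerivAt_id' (0 : ℂ)).const_mul (starRingEnd ℂ a)).const_add 1
  have h := h1.div h2 (by simp)
  have h' : deriv (discTranslationInv a) 0 = _ := h.deriv
  rw [h']
  simpa using e3

theorem discTranslationInv_zero (a : ℂ) : discTranslationInv a 0 = a := by
  simp [discTranslationInv]

theorem isOpen_hyperbolicTriangle (a b c : ℂ) : IsOpen (hyperbolicTriangle a b c) := by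
  have hk : Continuous kleinPoint := by
    unfold kleinPoint
    have h : Continuous fun z : ℂ => 2 / (1 + ‖z‖ ^ 2) :=
      Continuous.div (by fun_prop) (by fun_prop) fun z => by positivity
    exact h.smul continuous_id
  exact (isOpen_lt (continuous_norm (E := ℂ)) continuous_const).inter (isOpen_interior.preimage hk)

theorem hyperbolicTriangle_rotate (a b c : ℂ) :
    hyperbolicTriangle b c a = hyperbolicTriangle a b c := by
  have : ({kleinPoint b, kleinPoint c, kleinPoint a} : Set ℂ) =
      {kleinPoint a, kleinPoint b, kleinPoint c} := by
    ext; simp; tauto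
  simp only [hyperbolicTriangle, this]

/-- In the coordinate centred at the vertex `a`, the triangle with vertices `a`, `b`, `c` is, near
`a`, the open sector spanned by the directions of its two sides. -/
theorem eventually_discTranslationInv_mem_hyperbolicTriangle_iff {a b c : ℂ} (ha : ‖a‖ < 1)
    (hb : ‖b‖ < 1) (hc : ‖c‖ < 1) (hT : (hyperbolicTriangle a b c).Nonempty) :
    ∀ᶠ q : ℝ × ℝ in 𝓝 0,
      (discTranslationInv a (q.1 * discTranslation a b + q.2 * discTranslation a c) ∈
        hyperbolicTriangle a b c ↔ 0 < q.1 ∧ 0 < q.2) := by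
  obtain ⟨z, hz1, hz⟩ := hT
  have hiff := mem_interior_convexHull_triangle_iff ⟨_, hz⟩
  obtain ⟨rb, hrb, -, hb'⟩ := kleinPoint_sub_eq ha hb
  obtain ⟨rc, hrc, -, hc'⟩ := kleinPoint_sub_eq ha hc
  have ha2 : 0 < 1 - ‖a‖ ^ 2 := by nlinarith [norm_nonneg a]
  set M := 8 / (1 - ‖a‖ ^ 2) with hM
  have hM0 : 0 < M := by positivity
  have hc1 : ContinuousAt (fun q : ℝ × ℝ =>
      1 + starRingEnd ℂ a * (q.1 * discTranslation a b + q.2 * discTranslation a c)) 0 := by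
    fun_prop
  have hc2 : ContinuousAt (fun q : ℝ × ℝ =>
      discTranslationInv a (q.1 * discTranslation a b + q.2 * discTranslation a c)) 0 := by
    unfold discTranslationInv
    exact ContinuousAt.div (by fun_prop) hc1 (by simp)
  have hc3 : ContinuousAt (fun q : ℝ × ℝ => M * (q.1 / rb + q.2 / rc)) 0 := by fun_prop
  have h1 := hc1.eventually_ne (y := 0) (by simp)
  have h2 := hc2.norm.eventually_lt (continuousAt_const (y := (1 : ℝ)))
    (by simpa [discTranslationInv_zero] using ha)
  have h3 := hc3.eventually_lt (continuousAt_const (y := (1 : ℝ))) (by simp)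
  filter_upwards [h1, h2, h3] with q h1 h2 h3
  obtain ⟨r, hr, hrM, hk⟩ := kleinPoint_sub_eq ha h2
  rw [discTranslation_discTranslationInv ha h1, kleinDifferential_linear] at hk
  have hrb' : (rb : ℂ) ≠ 0 := by exact_mod_cast hrb.ne'
  have hrc' : (rc : ℂ) ≠ 0 := by exact_mod_cast hrc.ne'
  have hk2 : kleinPoint (discTranslationInv a
      (q.1 * discTranslation a b + q.2 * discTranslation a c)) =
      kleinPoint a + (r * q.1 / rb) • (kleinPoint b - kleinPoint a) +
        (r * q.2 / rc) • (kleinPoint c - kleinPoint a) := by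
    rw [← sub_eq_iff_eq_add'.2 (hk.trans ?_ : _ = (r * q.1 / rb) • (kleinPoint b - kleinPoint a) +
        (r * q.2 / rc) • (kleinPoint c - kleinPoint a))]
    · ring
    · rw [hb', hc', Complex.real_smul, Complex.real_smul]
      push_cast
      field_simp
  rw [hyperbolicTriangle, Set.mem_ofPred_eq, hk2, hiff]
  constructor
  · rintro ⟨-, h4, h5, -⟩
    have e1 : r * q.1 / rb = r / rb * q.1 := by ring
    have e2 : r * q.2 / rc = r / rc * q.2 := by ring
    rw [e1] at h4
    rw [e2] at h5
    exact ⟨pos_of_mul_pos_right h4 (by positivity), pos_of_mul_pos_right h5 (by positivity)⟩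
  · rintro ⟨h4, h5⟩
    refine ⟨h2, by positivity, by positivity, lt_of_le_of_lt ?_ h3⟩
    calc r * q.1 / rb + r * q.2 / rc = r * (q.1 / rb + q.2 / rc) := by ring
      _ ≤ M * (q.1 / rb + q.2 / rc) := by gcongr

theorem discTranslation_ne_zero {a b c : ℂ} (ha : ‖a‖ < 1) (hb : ‖b‖ < 1) (hc : ‖c‖ < 1)
    (hT : (hyperbolicTriangle a b c).Nonempty) :
    discTranslation a b ≠ 0 ∧ discTranslation a c ≠ 0 := by
  have h := eventually_discTranslationInv_mem_hyperbolicTriangle_iff ha hb hc hT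
  obtain ⟨ε, hε, h⟩ := Metric.eventually_nhds_iff.1 h
  have hd : ∀ x y : ℝ, |x| < ε → |y| < ε → dist ((x, y) : ℝ × ℝ) 0 < ε := by
    intro x y hx hy
    rw [Prod.dist_eq]
    simpa using ⟨hx, hy⟩
  have he : |ε / 2| < ε := by rw [abs_of_pos (by positivity)]; linarith
  have h0 : |(0 : ℝ)| < ε := by simpa using hε
  have h1 := (h (hd _ _ he he)).2 ⟨by positivity, by positivity⟩
  constructor
  · intro hu
    have h2 := h (hd 0 _ h0 he)
    simp only [hu, mul_zero] at h1 h2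
    exact lt_irrefl _ (h2.1 h1).1
  · intro hu
    have h2 := h (hd _ 0 he h0)
    simp only [hu, mul_zero] at h1 h2
    exact lt_irrefl _ (h2.1 h1).2

end

theorem meromorphicOrderAt_vertex {g : ℂ → ℂ} {a b c : ℂ} {l : ℕ} (hl : 2 ≤ l)
    (ha : ‖a‖ < 1) (hb : ‖b‖ < 1) (hc : ‖c‖ < 1)
    (hang : hyperbolicAngle a b c = Real.pi / l) (hm : MeromorphicAt g a)
    (hd : DifferentiableOn ℂ g (hyperbolicTriangle a b c))
    (hbij : Set.BijOn g (hyperbolicTriangle a b c) {w | 0 < w.im})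
    (ht : Tendsto g (𝓝[hyperbolicTriangle a b c] a) (𝓝 0)) :
    meromorphicOrderAt g a = (l : ℤ) := by
  have hT : (hyperbolicTriangle a b c).Nonempty := by
    obtain ⟨q, hq, -⟩ := hbij.surjOn (show Complex.I ∈ {w : ℂ | 0 < w.im} by simp)
    exact ⟨q, hq⟩
  obtain ⟨hu, hv⟩ := discTranslation_ne_zero ha hb hc hT
  obtain ⟨ε, hε, hmem⟩ := Metric.eventually_nhds_iff.1
    (eventually_discTranslationInv_mem_hyperbolicTriangle_iff ha hb hc hT)
  have hTo := isOpen_hyperbolicTriangle a b c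
  rw [hyperbolicAngle, if_pos ha] at hang
  set u := discTranslation a b
  set v := discTranslation a c
  set T := hyperbolicTriangle a b c
  set p := discTranslationInv a
  have hp0 : p 0 = a := discTranslationInv_zero a
  replace hmem : ∀ x y : ℝ, |x| < ε → |y| < ε → (p (x * u + y * v) ∈ T ↔ 0 < x ∧ 0 < y) := by
    intro x y hx hy
    refine hmem (y := (x, y)) ?_
    rw [Prod.dist_eq]
    simpa using ⟨hx, hy⟩
  have hpa : AnalyticAt ℂ p 0 := analyticAt_discTranslationInv (by simp)
  have hp' : deriv p 0 ≠ 0 := deriv_discTranslationInv_zero ha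
  have hpNE : Tendsto p (𝓝[≠] 0) (𝓝[≠] a) := by
    have := hpa.differentiableAt.hasDerivAt.tendsto_nhdsNE hp'
    rwa [hp0] at this
  have hsmall : ∀ x : ℝ, 0 ≤ x → ∀ᶠ t : ℝ in 𝓝[>] 0, |t * x| < ε := by
    intro x hx
    have h : ContinuousAt (fun t : ℝ => |t * x|) 0 := by fun_prop
    exact (h.eventually_lt (continuousAt_const (y := ε)) (by simpa using hε)).filter_mono
      nhdsWithin_le_nhds
  have hin : ∀ x y : ℝ, 0 < x → 0 < y → ∀ᶠ t : ℝ in 𝓝[>] 0, p (t * (x * u + y * v)) ∈ T := by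
    intro x y hx hy
    filter_upwards [hsmall x hx.le, hsmall y hy.le, self_mem_nhdsWithin] with t h1 h2 h3
    have h3' : 0 < t := h3
    have := (hmem (t * x) (t * y) h1 h2).2 ⟨by positivity, by positivity⟩
    push_cast at this
    rwa [mul_add, ← mul_assoc, ← mul_assoc]
  have hreal : ∀ w w' : ℂ, w ≠ 0 → (∀ t : ℝ, 0 < t → t < ε → p (t * w) ∉ T) →
      (∀ t r : ℝ, 0 < t → t < ε → 0 < r → r < ε → p (t * w + r * w') ∈ T) →
      ∀ᶠ t : ℝ in 𝓝[>] 0, ((g ∘ p) (t * w)).im = 0 := by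
    intro w w' hw hout hins
    filter_upwards [(hpNE.comp (tendsto_ofReal_mul_nhdsNE_zero hw)).eventually hm.eventually_analyticAt,
      (tendsto_ofReal_mul_nhdsNE_zero hw).eventually (hpa.eventually_analyticAt.filter_mono nhdsWithin_le_nhds),
      Ioo_mem_nhdsGT hε] with t hg hpt ht
    refine im_eq_zero_of_mem_closure_of_bijOn (g := g) (P := p (t * w)) hTo hd hbij ?_ (hout t ht.1 ht.2) hg.continuousAt
    have h1 : Tendsto (fun r : ℝ => p (t * w + r * w')) (𝓝[>] 0) (𝓝 (p (t * w))) := by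
      have h2 : Tendsto (fun r : ℝ => (t * w + r * w' : ℂ)) (𝓝[>] 0) (𝓝 (t * w)) := by
        have : Continuous fun r : ℝ => (t * w + r * w' : ℂ) := by fun_prop
        simpa using (this.tendsto 0).mono_left nhdsWithin_le_nhds
      exact hpt.continuousAt.tendsto.comp h2
    refine mem_closure_of_tendsto h1 ?_
    filter_upwards [Ioo_mem_nhdsGT hε] with r hr
    exact hins t r ht.1 ht.2 hr.1 hr.2
  have habs : ∀ {t : ℝ}, 0 < t → t < ε → |t| < ε := fun h1 h2 => by rwa [abs_of_pos h1]
  have h0ε : |(0 : ℝ)| < ε := by simpa using hε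
  have hur := hreal u v hu
    (fun t h1 h2 h => by
      have := (hmem t 0 (habs h1 h2) h0ε).1 (by simpa using h)
      exact lt_irrefl _ this.2)
    (fun t r h1 h2 h3 h4 => (hmem t r (habs h1 h2) (habs h3 h4)).2 ⟨h1, h3⟩)
  have hvr := hreal v u hv
    (fun t h1 h2 h => by
      have := (hmem 0 t h0ε (habs h1 h2)).1 (by simpa using h)
      exact lt_irrefl _ this.1)
    (fun t r h1 h2 h3 h4 => by
      rw [add_comm]
      exact (hmem r t (habs h3 h4) (habs h1 h2)).2 ⟨h3, h1⟩)
  have haT : a ∉ T := fun h => by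
    have := (hmem 0 0 h0ε h0ε).1 (by simpa [hp0] using h)
    exact lt_irrefl _ this.1
  have hle : 𝓝[T] a ≤ 𝓝[≠] a := nhdsWithin_mono _ fun z hz hza => haT (hza ▸ hz)
  have hne : (𝓝[T] a).NeBot := by
    have h1 : Tendsto (fun t : ℝ => p (t * ((1 : ℝ) * u + (1 : ℝ) * v))) (𝓝[>] 0) (𝓝[T] a) := by
      refine tendsto_nhdsWithin_iff.2 ⟨?_, hin 1 1 one_pos one_pos⟩
      have h2 : Tendsto (fun t : ℝ => (t : ℂ) * ((1 : ℝ) * u + (1 : ℝ) * v)) (𝓝[>] 0) (𝓝 0) := by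
        have : Continuous fun t : ℝ => (t : ℂ) * ((1 : ℝ) * u + (1 : ℝ) * v) := by fun_prop
        simpa using (this.tendsto 0).mono_left nhdsWithin_le_nhds
      have h3 := hpa.continuousAt.tendsto
      rw [hp0] at h3
      exact h3.comp h2
    exact h1.neBot
  have hpos : 0 < meromorphicOrderAt g a := by
    by_contra hcon
    rcases (not_lt.1 hcon).lt_or_eq with h | h
    · exact (ht.not_tendsto (Metric.disjoint_nhds_cobounded 0))
        ((tendsto_cobounded_of_meromorphicOrderAt_neg h).mono_left hle)
    · obtain ⟨e, he, hte⟩ := tendsto_ne_zero_of_meromorphicOrderAt_eq_zero hm h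
      exact he (tendsto_nhds_unique (hte.mono_left hle) ht)
  have hord : meromorphicOrderAt (g ∘ p) 0 = meromorphicOrderAt g a := by
    rw [meromorphicOrderAt_comp_of_deriv_ne_zero hpa hp', hp0]
  have hmF : MeromorphicAt (g ∘ p) 0 := MeromorphicAt.comp_analyticAt (by rwa [hp0]) hpa
  rw [← hord] at hpos ⊢
  exact meromorphicOrderAt_eq_of_sector hl hu hv hang hmF hpos hur hvr
    fun x y hx hy => (hin x y hx hy).mono fun t ht => hbij.mapsTo ht

theorem norm_lt_one_of_hyperbolicAngle_ne_zero {a b c : ℂ} (h : hyperbolicAngle a b c ≠ 0) :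
    ‖a‖ < 1 := by
  by_contra hn
  exact h (if_neg hn)

theorem IsDiscTriangleFunction.exists_meromorphicOrderAt_eq {l m n : ℕ} (hl : 2 ≤ l) (hm : 2 ≤ m)
    (hn : 2 ≤ n) {f : ℂ → ℂ}
    (hf : IsDiscTriangleFunction (1 / (l : ℝ)) (1 / (m : ℝ)) (1 / (n : ℝ)) f) :
    ∃ v₀ ∈ Metric.ball (0 : ℂ) 1, ∃ v₁ ∈ Metric.ball (0 : ℂ) 1, ∃ v₂ ∈ Metric.ball (0 : ℂ) 1,
      meromorphicOrderAt f v₀ = (l : ℤ) ∧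
      meromorphicOrderAt (fun z => f z - 1) v₁ = (m : ℤ) ∧
      meromorphicOrderAt f v₂ = (-n : ℤ) := by
  obtain ⟨hmer, v₀, v₁, v₂, -, -, -, hα, hβ, hγ, hd, hb, h0, h1, h2⟩ := hf
  rw [one_div_mul_eq_div] at hα hβ hγ
  have hang : ∀ {k : ℕ}, 2 ≤ k → Real.pi / (k : ℝ) ≠ 0 := fun {k} hk =>
    div_ne_zero Real.pi_ne_zero (by norm_cast; omega)
  have n0 : ‖v₀‖ < 1 := norm_lt_one_of_hyperbolicAngle_ne_zero (hα.trans_ne (hang hl))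
  have n1 : ‖v₁‖ < 1 := norm_lt_one_of_hyperbolicAngle_ne_zero (hβ.trans_ne (hang hm))
  have n2 : ‖v₂‖ < 1 := norm_lt_one_of_hyperbolicAngle_ne_zero (hγ.trans_ne (hang hn))
  have m0 : v₀ ∈ Metric.ball (0 : ℂ) 1 := by simpa using n0
  have m1 : v₁ ∈ Metric.ball (0 : ℂ) 1 := by simpa using n1
  have m2 : v₂ ∈ Metric.ball (0 : ℂ) 1 := by simpa using n2
  have r1 := hyperbolicTriangle_rotate v₀ v₁ v₂
  have r2 := (hyperbolicTriangle_rotate v₁ v₂ v₀).trans r1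
  refine ⟨v₀, m0, v₁, m1, v₂, m2, ?_, ?_, ?_⟩
  · exact meromorphicOrderAt_vertex hl n0 n1 n2 hα (hmer _ m0) hd hb h0
  · refine meromorphicOrderAt_vertex hm n1 n2 n0 hβ ((hmer _ m1).sub (MeromorphicAt.const 1 _))
      ?_ ?_ ?_
    · rw [r1]
      exact hd.sub_const 1
    · rw [r1]
      refine ⟨fun z hz => ?_, fun z hz z' hz' h => hb.injOn hz hz' (sub_left_injective h),
        fun w hw => ?_⟩
      · simpa using hb.mapsTo hz
      · obtain ⟨z, hz, hzw⟩ := hb.surjOn (show w + 1 ∈ {w : ℂ | 0 < w.im} by simpa using hw)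
        exact ⟨z, hz, by simp [hzw]⟩
    · rw [r1]
      simpa using h1.sub_const 1
  · have him : ∀ w : ℂ, 0 < w.im → 0 < (-w⁻¹).im := by
      intro w hw
      have hw0 : w ≠ 0 := by rintro rfl; simp at hw
      have : 0 < Complex.normSq w := Complex.normSq_pos.2 hw0
      rw [Complex.neg_im, Complex.inv_im, neg_div, neg_neg]
      positivity
    have hne : ∀ z ∈ hyperbolicTriangle v₀ v₁ v₂, f z ≠ 0 := by
      intro z hz h
      have := hb.mapsTo hz
      simp [h] at this
    have key : meromorphicOrderAt (fun z => -(f z)⁻¹) v₂ = (n : ℤ) := by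
      refine meromorphicOrderAt_vertex hn n2 n0 n1 hγ (hmer _ m2).inv.neg ?_ ?_ ?_
      · rw [r2]
        exact (hd.inv hne).neg
      · rw [r2]
        refine ⟨fun z hz => him _ (hb.mapsTo hz),
          fun z hz z' hz' h => hb.injOn hz hz' (inv_injective (neg_injective h)), fun w hw => ?_⟩
        obtain ⟨z, hz, hzw⟩ := hb.surjOn (him w hw)
        exact ⟨z, hz, by simp [hzw, inv_neg]⟩
      · rw [r2]
        simpa using (tendsto_inv₀_cobounded.comp h2).neg
    have key2 : meromorphicOrderAt (fun z => -(f z)⁻¹) v₂ = -meromorphicOrderAt f v₂ := by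
      rw [← meromorphicOrderAt_inv (f := f)]
      exact (meromorphicOrderAt_neg (f := f⁻¹)).symm
    rw [key] at key2
    cases h : meromorphicOrderAt f v₂ with
    | top => simp [h] at key2
    | coe k =>
      rw [h] at key2
      have : (n : ℤ) = -k := by exact_mod_cast key2
      rw [this, neg_neg]

theorem sum_mul_order_eq_zero {s y : ℂ → ℂ} {p a₁ a₂ a₃ : ℂ} {n₁ n₂ n₃ : ℤ}
    (hs : MeromorphicAt s p) (hy : ContinuousAt y p)
    (h : ∀ᶠ z in 𝓝[≠] p, y z = a₁ * gdhW₁ s z + a₂ * gdhW₂ s z + a₃ * gdhW₃ s z)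
    (h₁ : meromorphicOrderAt (fun t => deriv s t / s t) p = n₁)
    (h₂ : meromorphicOrderAt (fun t => deriv s t / (s t - 1)) p = n₂)
    (h₃ : meromorphicOrderAt (fun t => deriv s t / (s t * (s t - 1))) p = n₃) :
    a₁ * n₁ + a₂ * n₂ + a₃ * n₃ = 0 := by
  have hs1 : MeromorphicAt (fun t => s t - 1) p := hs.sub (MeromorphicAt.const 1 p)
  have t₁ := tendsto_sub_mul_logDeriv (hs.deriv.div hs) h₁
  have t₂ := tendsto_sub_mul_logDeriv (hs.deriv.div hs1) h₂
  have t₃ := tendsto_sub_mul_logDeriv (hs.deriv.div (hs.mul hs1)) h₃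
  have t : Tendsto (fun z => (z - p) * y z) (𝓝[≠] p)
      (𝓝 (a₁ * (1 / 2) * n₁ + a₂ * (1 / 2) * n₂ + a₃ * (1 / 2) * n₃)) := by
    refine (((t₁.const_mul _).add (t₂.const_mul _)).add (t₃.const_mul _)).congr' ?_
    filter_upwards [h] with z hz
    rw [hz, gdhW₁, gdhW₂, gdhW₃]
    simp only [Pi.div_def, Pi.mul_def]
    ring
  have t0 : Tendsto (fun z => (z - p) * y z) (𝓝[≠] p) (𝓝 0) := by
    have hc : ContinuousAt (fun z => (z - p) * y z) p := by fun_prop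
    simpa using hc.tendsto.mono_left (nhdsWithin_le_nhds (s := {p}ᶜ))
  linear_combination 2 * tendsto_nhds_unique t t0

theorem meromorphicOrderAt_add_const_of_pos {f : ℂ → ℂ} {p c : ℂ} (hc : c ≠ 0)
    (h : 0 < meromorphicOrderAt f p) : meromorphicOrderAt (fun z => f z + c) p = 0 := by
  classical
  have hco : meromorphicOrderAt (fun _ : ℂ => c) p = 0 := by
    rw [meromorphicOrderAt_const, if_neg hc]
  have := meromorphicOrderAt_add_eq_right_of_lt (f₂ := fun _ => c)
    (meromorphicAt_of_meromorphicOrderAt_ne_zero h.ne') (by rwa [hco])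
  rw [hco] at this
  exact this

theorem meromorphicOrderAt_add_const_of_neg {f : ℂ → ℂ} {p c : ℂ} (hc : c ≠ 0)
    (h : meromorphicOrderAt f p < 0) :
    meromorphicOrderAt (fun z => f z + c) p = meromorphicOrderAt f p := by
  classical
  have hco : meromorphicOrderAt (fun _ : ℂ => c) p = 0 := by
    rw [meromorphicOrderAt_const, if_neg hc]
  exact meromorphicOrderAt_add_eq_left_of_lt (f₂ := fun _ => c) (MeromorphicAt.const c p)
    (by rwa [hco])

theorem sum_order_sub_eq_zero {s y : ℂ → ℂ} {p a₁ a₂ a₃ : ℂ} {k i j : ℤ}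
    (hs : MeromorphicAt s p) (hy : ContinuousAt y p)
    (h : ∀ᶠ z in 𝓝[≠] p, y z = a₁ * gdhW₁ s z + a₂ * gdhW₂ s z + a₃ * gdhW₃ s z)
    (hk : meromorphicOrderAt (deriv s) p = k) (hi : meromorphicOrderAt s p = i)
    (hj : meromorphicOrderAt (fun z => s z - 1) p = j) :
    a₁ * (k - i) + a₂ * (k - j) + a₃ * (k - i - j) = 0 := by
  have hs1 : MeromorphicAt (fun t => s t - 1) p := hs.sub (MeromorphicAt.const 1 p)
  have h₁ : meromorphicOrderAt (fun t => deriv s t / s t) p = (k - i : ℤ) := by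
    refine (meromorphicOrderAt_div hs.deriv hs).trans ?_
    rw [hk, hi]
    rfl
  have h₂ : meromorphicOrderAt (fun t => deriv s t / (s t - 1)) p = (k - j : ℤ) := by
    refine (meromorphicOrderAt_div hs.deriv hs1).trans ?_
    rw [hk, hj]
    rfl
  have h₃ : meromorphicOrderAt (fun t => deriv s t / (s t * (s t - 1))) p =
      (k - (i + j) : ℤ) := by
    refine (meromorphicOrderAt_div hs.deriv (hs.mul hs1)).trans ?_
    rw [hk, meromorphicOrderAt_mul hs hs1, hi, hj]
    rfl
  have := sum_mul_order_eq_zero hs hy h h₁ h₂ h₃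
  push_cast at this
  linear_combination this

theorem analyticAt_moebius {a b c d ζ : ℂ} (h : c * ζ + d ≠ 0) :
    AnalyticAt ℂ (fun ζ => (a * ζ + b) / (c * ζ + d)) ζ :=
  AnalyticAt.div (by fun_prop) (by fun_prop) h

theorem deriv_moebius_ne_zero {a b c d ζ : ℂ} (hdet : a * d - b * c ≠ 0) (h : c * ζ + d ≠ 0) :
    deriv (fun ζ => (a * ζ + b) / (c * ζ + d)) ζ ≠ 0 := by
  have h1 : HasDerivAt (fun ζ : ℂ => a * ζ + b) a ζ := by
    simpa using ((hasDerivAt_id' ζ).const_mul a).add_const b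
  have h2 : HasDerivAt (fun ζ : ℂ => c * ζ + d) c ζ := by
    simpa using ((hasDerivAt_id' ζ).const_mul c).add_const d
  have h3 : deriv (fun ζ => (a * ζ + b) / (c * ζ + d)) ζ = _ := (h1.div h2 h).deriv
  rw [h3]
  refine div_ne_zero ?_ (pow_ne_zero 2 h)
  convert hdet using 1
  ring

theorem image_moebius_mem_nhds {a b c d ζ : ℂ} {U : Set ℂ} (hU : U ∈ 𝓝 ζ)
    (hdet : a * d - b * c ≠ 0) (h : c * ζ + d ≠ 0) :
    (fun ζ => (a * ζ + b) / (c * ζ + d)) '' U ∈ 𝓝 ((a * ζ + b) / (c * ζ + d)) := by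
  have hA := analyticAt_moebius (a := a) (b := b) h
  have := hA.hasStrictDerivAt.map_nhds_eq (deriv_moebius_ne_zero hdet h)
  rw [← this]
  exact image_mem_map hU

theorem proposition1 (α β γ : ℝ)
    (hα : α = 0 ∨ ∃ n : ℕ, 0 < n ∧ α = 1 / (n : ℝ))
    (hβ : β = 0 ∨ ∃ n : ℕ, 0 < n ∧ β = 1 / (n : ℝ))
    (hγ : γ = 0 ∨ ∃ n : ℕ, 0 < n ∧ γ = 1 / (n : ℝ))
    (hsum : α + β + γ < 1)
    (D : Set ℂ) (s : ℂ → ℂ) (hs : IsSchwarzTriangleFunction α β γ D s)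
    (a₁ a₂ a₃ : ℂ) (ha : ¬ (a₁ = 0 ∧ a₂ = 0 ∧ a₃ = 0))
    (y : ℂ → ℂ) (hy : IsChazySolutionOn y D) (hpar : IsParametrizedBy y D s a₁ a₂ a₃)
    (hhol : DifferentiableOn ℂ y D) :
    α = 0 ∨ β = 0 ∨ γ = 0 := by
  by_contra! hne
  obtain ⟨hα0, hβ0, hγ0⟩ := hne
  obtain ⟨l, hl, rfl⟩ := hα.resolve_left hα0
  obtain ⟨m, hm, rfl⟩ := hβ.resolve_left hβ0
  obtain ⟨n, hn, rfl⟩ := hγ.resolve_left hγ0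
  have hlp : 0 < 1 / (l : ℝ) := by positivity
  have hmp : 0 < 1 / (m : ℝ) := by positivity
  have hnp : 0 < 1 / (n : ℝ) := by positivity
  have htwo : ∀ k : ℕ, 0 < k → 1 / (k : ℝ) < 1 → 2 ≤ k := by
    intro k hk h
    by_contra hlt
    obtain rfl : k = 1 := by omega
    norm_num at h
  have hl2 := htwo l hl (by linarith)
  have hm2 := htwo m hm (by linarith)
  have hn2 := htwo n hn (by linarith)
  obtain ⟨a, b, c, d, hdet, hden, rfl, hf⟩ := hs
  obtain ⟨v₀, m0, v₁, m1, v₂, m2, o0, o1, o2⟩ := hf.exists_meromorphicOrderAt_eq hl2 hm2 hn2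
  set μ : ℂ → ℂ := fun ζ => (a * ζ + b) / (c * ζ + d) with hμ
  have hord : ∀ v ∈ Metric.ball (0 : ℂ) 1, ∀ g : ℂ → ℂ,
      meromorphicOrderAt g (μ v) = meromorphicOrderAt (fun ζ => g (μ ζ)) v := fun v hv g =>
    (meromorphicOrderAt_comp_of_deriv_ne_zero (analyticAt_moebius (hden v hv))
      (deriv_moebius_ne_zero hdet (hden v hv))).symm
  have hmer : ∀ v ∈ Metric.ball (0 : ℂ) 1, MeromorphicAt s (μ v) := fun v hv =>
    (meromorphicAt_comp_iff_of_deriv_ne_zero (analyticAt_moebius (hden v hv))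
      (deriv_moebius_ne_zero hdet (hden v hv))).1 (hf.1 v hv)
  have hD : ∀ v ∈ Metric.ball (0 : ℂ) 1, μ '' Metric.ball (0 : ℂ) 1 ∈ 𝓝 (μ v) := fun v hv =>
    image_moebius_mem_nhds (Metric.isOpen_ball.mem_nhds hv) hdet (hden v hv)
  have hcont : ∀ v ∈ Metric.ball (0 : ℂ) 1, ContinuousAt y (μ v) := fun v hv =>
    (hhol.differentiableAt (hD v hv)).continuousAt
  have hev : ∀ v ∈ Metric.ball (0 : ℂ) 1, ∀ᶠ z in 𝓝[≠] (μ v),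
      y z = a₁ * gdhW₁ s z + a₂ * gdhW₂ s z + a₃ * gdhW₃ s z := by
    intro v hv
    have h := mem_codiscreteWithin_iff_forall_mem_nhdsNE.1 hpar (μ v) ⟨v, hv, rfl⟩
    filter_upwards [h, mem_nhdsWithin_of_mem_nhds (hD v hv)] with z hz hzD
    exact hz.resolve_right fun hc => hc hzD
  rw [← hord v₀ m0 s] at o0
  rw [← hord v₁ m1 (fun z => s z - 1)] at o1
  rw [← hord v₂ m2 s] at o2
  have hl0 : (l : ℤ) ≠ 0 := by omega
  have hm0 : (m : ℤ) ≠ 0 := by omega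
  have hn0 : (-n : ℤ) ≠ 0 := by omega
  have d0 := meromorphicOrderAt_deriv_eq_sub_one (by exact_mod_cast hl0) o0
  have d1 := meromorphicOrderAt_deriv_eq_sub_one (by exact_mod_cast hm0) o1
  have d2 := meromorphicOrderAt_deriv_eq_sub_one (by exact_mod_cast hn0) o2
  have hds : deriv (fun z => s z - 1) = deriv s := by
    ext z; exact deriv_sub_const 1
  rw [hds] at d1
  have q0 : meromorphicOrderAt (fun z => s z - 1) (μ v₀) = (0 : ℤ) := by
    refine meromorphicOrderAt_add_const_of_pos (c := -1) (by simp) ?_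
    rw [o0]; exact_mod_cast hl
  have q1 : meromorphicOrderAt s (μ v₁) = (0 : ℤ) := by
    have := meromorphicOrderAt_add_const_of_pos (f := fun z => s z - 1) (p := μ v₁) one_ne_zero
      (by rw [o1]; exact_mod_cast hm)
    simpa using this
  have q2 : meromorphicOrderAt (fun z => s z - 1) (μ v₂) = (-n : ℤ) := by
    rw [← o2]
    refine meromorphicOrderAt_add_const_of_neg (c := -1) (by simp) ?_
    rw [o2]
    have : (-n : ℤ) < 0 := by omega
    exact_mod_cast this
  have e0 := sum_order_sub_eq_zero (hmer _ m0) (hcont _ m0) (hev _ m0) d0 o0 q0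
  have e1 := sum_order_sub_eq_zero (hmer _ m1) (hcont _ m1) (hev _ m1) d1 q1 o1
  have e2 := sum_order_sub_eq_zero (hmer _ m2) (hcont _ m2) (hev _ m2) d2 o2 q2
  push_cast at e0 e1 e2
  have hlC : (l : ℂ) ≠ 0 := by exact_mod_cast hl.ne'
  have hmC : (m : ℂ) ≠ 0 := by exact_mod_cast hm.ne'
  have hnC : (n : ℂ) ≠ 0 := by exact_mod_cast hn.ne'
  set σ := a₁ + a₂ + a₃ with hσ
  have f0 : a₂ = σ / l := by rw [eq_div_iff hlC]; linear_combination e0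
  have f1 : a₁ = σ / m := by rw [eq_div_iff hmC]; linear_combination e1
  have f2 : a₃ = σ / n := by rw [eq_div_iff hnC]; linear_combination e2
  have hfac : ((1 - (1 / l + 1 / m + 1 / n) : ℝ) : ℂ) * σ = 0 := by
    push_cast
    linear_combination hσ + f0 + f1 + f2
  have hσ0 : σ = 0 := by
    refine (mul_eq_zero.1 hfac).resolve_left ?_
    exact_mod_cast (by linarith : (1 - (1 / l + 1 / m + 1 / n) : ℝ) ≠ 0)
  exact ha ⟨by rw [f1, hσ0, zero_div], by rw [f0, hσ0, zero_div], by rw [f2, hσ0, zero_div]⟩
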